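/- Let $\underline t>0$ and $S^1=\mathbb R/2\pi\mathbb Z$. Let $\gamma:[0,\underline t)\times S^1\to\mathbb R^3$ be a family of regular closed curves $\Gamma_t=\gamma(t,S^1)$ (that is, $g:=\|\partial_u\gamma\|>0$), and let $\theta:[0,\underline t)\times S^1\to S^1$ be an angle function. Assume that $\gamma$ is $C^1$ in $t$ and $C^4$ in $u$, that $\theta$ is $C^1$ in $t$ and $C^2$ in $u$, and that these derivatives are jointly continuous on $[0,\underline t)\times S^1$ (one-sided in $t$ at $t=0$). Write $ds=g\,du$ and $\partial_s=g^{-1}\partial_u$. Let $T,N,B$ be the Frenet frame of $\Gamma_t$, with curvature $\kappa$ and torsion $\tau$, and put $$\nu_\theta=\cos\theta\,N+\sin\theta\,B,\qquad \psi_1=\kappa\cos\theta,\quad \psi_2=\kappa\sin\theta,\quad \psi_3=\tau+\partial_s\theta .$$ Assume that $\psi_2\neq0$ everywhere on $[0,\underline t)\times S^1$ (in particular $\kappa>0$), and that $(\gamma,\theta)$ solves the framed curvature flow $$\partial_t\gamma=\kappa\,\nu_\theta,\qquad \partial_t\theta=\upsilon_\theta\qquad\text{on }[0,\underline t)\times S^1,$$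 with the $\theta$-velocity that prescribes Gaussian curvature $K=0$ for the trajectory surface $\bigcup_{t}\Gamma_t$ (so that this surface is developable), namely $$\upsilon_\theta=-\frac{\kappa\,\partial_s\psi_3+2\,\partial_s\kappa\,\psi_3}{\kappa^{2}}\,\psi_1-\frac{\kappa\,\psi_3^2}{\psi_2}-\frac{\partial_s^2\kappa-\kappa\psi_3^2}{\kappa^{2}}\,\psi_2 .$$ Then $\int_{\Gamma_t}\psi_1\,ds$ is conserved in time: $$\int_{\Gamma_t}\psi_1\,ds=\int_{\Gamma_0}\psi_1\,ds\qquad\text{for all }t\in[0,\underline t).$$ -/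

import Mathlib

open Set
open scoped Real RealInnerProductSpace

noncomputable section

/-- Euclidean three-space. -/
abbrev E3 : Type := EuclideanSpace ℝ (Fin 3)

namespace FramedCurve

/-- The vector product on Euclidean three-space. -/
def cross (a b : E3) : E3 := WithLp.toLp 2 (crossProduct (WithLp.ofLp a) (WithLp.ofLp b))

/-- The rate of parametrization `g = ‖∂ᵤ c‖` of a parametrized space curve `c`. -/
def speed (c : ℝ → E3) (u : ℝ) : ℝ := ‖deriv c u‖

/-- The arclength derivative `∂ₛ f = g⁻¹ ∂ᵤ f` along the curve `c`. -/
def arcDeriv {F : Type*} [NormedAddCommGroup F] [NormedSpace ℝ F]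
    (c : ℝ → E3) (f : ℝ → F) (u : ℝ) : F := (speed c u)⁻¹ • deriv f u

/-- The unit tangent `T = ∂ₛ c`. -/
def tangent (c : ℝ → E3) (u : ℝ) : E3 := arcDeriv c c u

/-- The curvature `κ = ‖∂ₛ T‖`. -/
def curvature (c : ℝ → E3) (u : ℝ) : ℝ := ‖arcDeriv c (tangent c) u‖

/-- The Frenet normal `N = κ⁻¹ ∂ₛ T` (equal to `0` where `κ = 0`). -/
def normal (c : ℝ → E3) (u : ℝ) : E3 := (curvature c u)⁻¹ • arcDeriv c (tangent c) u

/-- The Frenet binormal `B = T × N`. -/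
def binormal (c : ℝ → E3) (u : ℝ) : E3 := cross (tangent c u) (normal c u)

/-- The torsion `τ = ⟨∂ₛ N, B⟩`. -/
def torsion (c : ℝ → E3) (u : ℝ) : ℝ := ⟪arcDeriv c (normal c) u, binormal c u⟫

/-- The `θ`-normal `ν = cos θ N + sin θ B` of the curve `c` framed by the angle `φ`. -/
def thetaNormal (c : ℝ → E3) (φ : ℝ → ℝ) (u : ℝ) : E3 :=
  Real.cos (φ u) • normal c u + Real.sin (φ u) • binormal c u

/-- `ψ₁ = κ cos θ`. -/
def psiOne (c : ℝ → E3) (φ : ℝ → ℝ) (u : ℝ) : ℝ := curvature c u * Real.cos (φ u)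

/-- `ψ₂ = κ sin θ`. -/
def psiTwo (c : ℝ → E3) (φ : ℝ → ℝ) (u : ℝ) : ℝ := curvature c u * Real.sin (φ u)

/-- The generalised torsion `ψ₃ = τ + ∂ₛ θ`. -/
def psiThree (c : ℝ → E3) (φ : ℝ → ℝ) (u : ℝ) : ℝ := torsion c u + arcDeriv c φ u

/-- The `θ`-velocity prescribing the Gaussian curvature `K` of the trajectory surface:
`- κ ψ₂⁻¹ K - (κ ∂ₛψ₃ + 2 ∂ₛκ ψ₃) κ⁻² ψ₁ - κ ψ₂⁻¹ ψ₃² - (∂ₛ²κ - κ ψ₃²) κ⁻² ψ₂`.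
It is meaningful where `ψ₂ ≠ 0` (hence `κ ≠ 0`). -/
def cgcVelocity (K : ℝ) (c : ℝ → E3) (φ : ℝ → ℝ) (u : ℝ) : ℝ :=
  - (curvature c u * (psiTwo c φ u)⁻¹ * K)
  - (curvature c u * arcDeriv c (psiThree c φ) u
      + 2 * arcDeriv c (curvature c) u * psiThree c φ u)
      * ((curvature c u) ^ 2)⁻¹ * psiOne c φ u
  - curvature c u * (psiTwo c φ u)⁻¹ * psiThree c φ u ^ 2
  - (arcDeriv c (arcDeriv c (curvature c)) u - curvature c u * psiThree c φ u ^ 2)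
      * ((curvature c u) ^ 2)⁻¹ * psiTwo c φ u

/-- The integral `∫ f ds` over one period of a `2π`-periodically parametrized closed curve `c`. -/
def curveIntegral (c : ℝ → E3) (f : ℝ → ℝ) : ℝ := ∫ u in (0 : ℝ)..(2 * π), f u * speed c u

/-- `f` has partial derivatives in `u` up to order `n`, jointly continuous on `[0, tEnd) × ℝ`. -/
def SpatiallyContDiff {F : Type*} [NormedAddCommGroup F] [NormedSpace ℝ F]
    (tEnd : ℝ) (n : ℕ) (f : ℝ → ℝ → F) : Prop :=
  (∀ t ∈ Ico 0 tEnd, ContDiff ℝ n (f t)) ∧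
  ∀ k ≤ n, ContinuousOn (fun p : ℝ × ℝ => iteratedDeriv k (f p.1) p.2) (Ico 0 tEnd ×ˢ univ)

/-- The family of closed framed curves `(γ t, θ t)`, `t ∈ [0, tEnd)`, solves the framed curvature
flow `∂ₜγ = κ ν`, `∂ₜθ = υ`, with initial datum `(γ 0, θ 0)`. Functions on the circle `ℝ / 2πℤ` are
given by their pull-backs to `ℝ`, and the circle-valued angle by a real-valued lift. Time
derivatives at `t = 0` are one-sided. -/
structure IsFramedCurvatureFlow (tEnd : ℝ) (γ : ℝ → ℝ → E3) (θ υ : ℝ → ℝ → ℝ) : Prop where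
  tEnd_pos : 0 < tEnd
  periodic : ∀ t ∈ Ico 0 tEnd, ∀ u, γ t (u + 2 * π) = γ t u
  angle_periodic : ∀ t ∈ Ico 0 tEnd, ∀ u, (θ t (u + 2 * π) : Real.Angle) = (θ t u : Real.Angle)
  regular : ∀ t ∈ Ico 0 tEnd, ∀ u, deriv (γ t) u ≠ 0
  curve_contDiff : SpatiallyContDiff tEnd 4 γ
  angle_contDiff : SpatiallyContDiff tEnd 2 θ
  velocity_continuous : ContinuousOn (fun p : ℝ × ℝ => υ p.1 p.2) (Ico 0 tEnd ×ˢ univ)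
  curve_evolution : ∀ t ∈ Ico 0 tEnd, ∀ u,
    HasDerivWithinAt (fun r => γ r u) (curvature (γ t) u • thetaNormal (γ t) (θ t) u)
      (Ico 0 tEnd) t
  angle_evolution : ∀ t ∈ Ico 0 tEnd, ∀ u,
    HasDerivWithinAt (fun r => θ r u) (υ t u) (Ico 0 tEnd) t

end FramedCurve

end

noncomputable section

namespace FramedCurve

/-! The density `ψ₁ g` satisfies a conservation law: ∂ₜ(ψ₁ g) = ∂ᵤ(∂ₛκ), and the flux ∂ₛκ is
periodic. Indeed, with V = κν, the Frenet equations give ∂ₜg = -κψ₁g and ∂ₜκ = (∂ₛ²κ - κψ₃²) cos θ -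
(2∂ₛκ ψ₃ + κ∂ₛψ₃) sin θ + κ²ψ₁, while the angle contributes -ψ₂υ to ∂ₜψ₁. For K = 0 the mixed terms
cancel, cos² + sin² = 1 collects ∂ₛ²κ, and g∂ₛ²κ = ∂ᵤ∂ₛκ remains (`hasDerivAt_psiOne_mul_speed`).

The analytic difficulty is that γ is only C¹ in t. Since V is C² in u,
`hasDerivAt_deriv_of_evolution` gives time derivatives of ∂ᵤγ and ∂ᵤ²γ, and g and κ depend on
nothing else. `integral_eq_of_evolution_deriv` then integrates the conservation law over space-time.
-/

theorem hasDerivAt_norm_of_ne_zero {E : Type*} [NormedAddCommGroup E] [InnerProductSpace ℝ E]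
    {f : ℝ → E} {f' : E} {x : ℝ} (hf : HasDerivAt f f' x) (h0 : f x ≠ 0) :
    HasDerivAt (fun y => ‖f y‖) (⟪f x, f'⟫ * ‖f x‖⁻¹) x := by
  have hn := norm_ne_zero_iff.2 h0
  have h := (hf.norm_sq).sqrt (by positivity)
  simp only [Real.sqrt_sq (norm_nonneg _)] at h
  convert h using 1
  field_simp

/-! ### Calculus of joint regularity in the space variable. -/

section SliceContDiff

variable {E F G : Type*} [NormedAddCommGroup E] [NormedSpace ℝ E] [NormedAddCommGroup F]
  [NormedSpace ℝ F] [NormedAddCommGroup G] [NormedSpace ℝ G] {I : Set ℝ}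

/-- `f` has partial derivatives in its second variable up to order `n`, jointly continuous
on `I × ℝ`. -/
def SliceContDiff (I : Set ℝ) : ℕ → (ℝ → ℝ → F) → Prop
  | 0, f => ContinuousOn (fun p : ℝ × ℝ => f p.1 p.2) (I ×ˢ univ)
  | n + 1, f => ContinuousOn (fun p : ℝ × ℝ => f p.1 p.2) (I ×ˢ univ) ∧
      (∀ t ∈ I, Differentiable ℝ (f t)) ∧ SliceContDiff I n (fun t => deriv (f t))

namespace SliceContDiff

theorem continuousOn {n : ℕ} {f : ℝ → ℝ → F} (h : SliceContDiff I n f) :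
    ContinuousOn (fun p : ℝ × ℝ => f p.1 p.2) (I ×ˢ univ) := by
  cases n with
  | zero => exact h
  | succ n => exact h.1

theorem hasDerivAt {n : ℕ} {f : ℝ → ℝ → F} (h : SliceContDiff I (n + 1) f) {t : ℝ} (ht : t ∈ I)
    (u : ℝ) : HasDerivAt (f t) (deriv (f t) u) u :=
  (h.2.1 t ht u).hasDerivAt

theorem deriv {n : ℕ} {f : ℝ → ℝ → F} (h : SliceContDiff I (n + 1) f) :
    SliceContDiff I n (fun t => deriv (f t)) := h.2.2

theorem of_succ {n : ℕ} {f : ℝ → ℝ → F} (h : SliceContDiff I (n + 1) f) :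
    SliceContDiff I n f := by
  induction n generalizing f with
  | zero => exact h.1
  | succ n ih => exact ⟨h.1, h.2.1, ih h.2.2⟩

theorem congr {n : ℕ} {f g : ℝ → ℝ → F} (h : SliceContDiff I n f)
    (hfg : ∀ t ∈ I, ∀ u, g t u = f t u) : SliceContDiff I n g := by
  induction n generalizing f g with
  | zero => exact ContinuousOn.congr h fun p hp => hfg p.1 hp.1 p.2
  | succ n ih =>
    have hfun : ∀ t ∈ I, g t = f t := fun t ht => funext (hfg t ht)
    refine ⟨h.1.congr fun p hp => hfg p.1 hp.1 p.2, fun t ht => ?_, ih h.2.2 fun t ht u => ?_⟩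
    · rw [hfun t ht]; exact h.2.1 t ht
    · rw [hfun t ht]

theorem of_hasDerivAt {n : ℕ} {f f' : ℝ → ℝ → F}
    (hf : ContinuousOn (fun p : ℝ × ℝ => f p.1 p.2) (I ×ˢ univ))
    (hderiv : ∀ t ∈ I, ∀ u, HasDerivAt (f t) (f' t u) u) (hf' : SliceContDiff I n f') :
    SliceContDiff I (n + 1) f :=
  ⟨hf, fun t ht u => (hderiv t ht u).differentiableAt,
    hf'.congr fun t ht u => (hderiv t ht u).deriv⟩

theorem add {n : ℕ} {f g : ℝ → ℝ → F} (hf : SliceContDiff I n f) (hg : SliceContDiff I n g) :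
    SliceContDiff I n (fun t u => f t u + g t u) := by
  induction n generalizing f g with
  | zero => exact ContinuousOn.add hf hg
  | succ n ih =>
    exact of_hasDerivAt (hf.continuousOn.add hg.continuousOn)
      (fun t ht u => (hf.hasDerivAt ht u).add (hg.hasDerivAt ht u)) (ih hf.deriv hg.deriv)

theorem bilinear (L : E →L[ℝ] F →L[ℝ] G) {n : ℕ} {f : ℝ → ℝ → E} {g : ℝ → ℝ → F}
    (hf : SliceContDiff I n f) (hg : SliceContDiff I n g) :
    SliceContDiff I n (fun t u => L (f t u) (g t u)) := by
  induction n generalizing f g with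
  | zero => exact (L.continuous.comp_continuousOn hf).clm_apply hg
  | succ n ih =>
    exact of_hasDerivAt ((L.continuous.comp_continuousOn hf.continuousOn).clm_apply hg.continuousOn)
      (fun t ht u => L.hasDerivAt_of_bilinear (fun _ => hf.hasDerivAt ht u)
        (fun _ => hg.hasDerivAt ht u))
      ((ih hf.of_succ hg.deriv).add (ih hf.deriv hg.of_succ))

theorem smul {n : ℕ} {f : ℝ → ℝ → ℝ} {g : ℝ → ℝ → F}
    (hf : SliceContDiff I n f) (hg : SliceContDiff I n g) :
    SliceContDiff I n (fun t u => f t u • g t u) :=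
  bilinear (ContinuousLinearMap.lsmul ℝ ℝ) hf hg

theorem mul {n : ℕ} {f g : ℝ → ℝ → ℝ} (hf : SliceContDiff I n f) (hg : SliceContDiff I n g) :
    SliceContDiff I n (fun t u => f t u * g t u) :=
  hf.smul hg

theorem const_mul {n : ℕ} {f : ℝ → ℝ → ℝ} (a : ℝ) (hf : SliceContDiff I n f) :
    SliceContDiff I n (fun t u => a * f t u) := by
  induction n generalizing f with
  | zero => exact ContinuousOn.mul continuousOn_const hf
  | succ n ih =>
    exact of_hasDerivAt (continuousOn_const.mul hf.continuousOn)
      (fun t ht u => (hf.hasDerivAt ht u).const_mul a) (ih hf.deriv)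

theorem inner {E : Type*} [NormedAddCommGroup E] [InnerProductSpace ℝ E] {n : ℕ}
    {f g : ℝ → ℝ → E} (hf : SliceContDiff I n f) (hg : SliceContDiff I n g) :
    SliceContDiff I n (fun t u => ⟪f t u, g t u⟫) :=
  bilinear (innerSL ℝ) hf hg

theorem inv {n : ℕ} {f : ℝ → ℝ → ℝ} (hf : SliceContDiff I n f)
    (h0 : ∀ t ∈ I, ∀ u, f t u ≠ 0) : SliceContDiff I n (fun t u => (f t u)⁻¹) := by
  induction n generalizing f with
  | zero => exact ContinuousOn.inv₀ hf fun p hp => h0 p.1 hp.1 p.2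
  | succ n ih =>
    have hi := ih hf.of_succ h0
    refine of_hasDerivAt (hf.continuousOn.inv₀ fun p hp => h0 p.1 hp.1 p.2)
      (fun t ht u => (hf.hasDerivAt ht u).inv (h0 t ht u))
      -- Written as -f' f⁻¹ f⁻¹, the derivative involves f⁻¹ only at the lower order supplied by
      -- induction.
      (((hf.deriv.mul (hi.mul hi)).const_mul (-1)).congr fun t ht u => ?_)
    have := h0 t ht u
    field_simp

theorem norm {E : Type*} [NormedAddCommGroup E] [InnerProductSpace ℝ E] {n : ℕ}
    {f : ℝ → ℝ → E} (hf : SliceContDiff I n f) (h0 : ∀ t ∈ I, ∀ u, f t u ≠ 0) :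
    SliceContDiff I n (fun t u => ‖f t u‖) := by
  induction n with
  | zero => exact ContinuousOn.norm hf
  | succ n ih =>
    refine of_hasDerivAt hf.continuousOn.norm
      (fun t ht u => hasDerivAt_norm_of_ne_zero (hf.hasDerivAt ht u) (h0 t ht u))
      ((hf.of_succ.inner hf.deriv).mul
        ((ih hf.of_succ).inv fun t ht u => norm_ne_zero_iff.2 (h0 t ht u)))

/-- Each function is, up to sign, a factor in the derivative of the other, so the induction must
carry both. -/
theorem cos_sin {n : ℕ} {f : ℝ → ℝ → ℝ} (hf : SliceContDiff I n f) :
    SliceContDiff I n (fun t u => Real.cos (f t u)) ∧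
      SliceContDiff I n (fun t u => Real.sin (f t u)) := by
  induction n with
  | zero =>
    exact ⟨Real.continuous_cos.comp_continuousOn hf, Real.continuous_sin.comp_continuousOn hf⟩
  | succ n ih =>
    obtain ⟨hc, hs⟩ := ih hf.of_succ
    exact ⟨of_hasDerivAt (Real.continuous_cos.comp_continuousOn hf.continuousOn)
        (fun t ht u => (hf.hasDerivAt ht u).cos) ((hs.const_mul (-1)).mul hf.deriv |>.congr
          fun t ht u => by ring),
      of_hasDerivAt (Real.continuous_sin.comp_continuousOn hf.continuousOn)
        (fun t ht u => (hf.hasDerivAt ht u).sin) (hc.mul hf.deriv)⟩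

theorem continuous {n : ℕ} {f : ℝ → ℝ → F} (h : SliceContDiff I n f) {t : ℝ} (ht : t ∈ I) :
    Continuous (f t) := by
  rw [← continuousOn_univ]
  exact h.continuousOn.comp (by fun_prop : ContinuousOn (fun u : ℝ => (t, u)) univ)
    fun u _ => ⟨ht, mem_univ u⟩

end SliceContDiff

theorem SpatiallyContDiff.sliceContDiff {tEnd : ℝ} {n : ℕ} {f : ℝ → ℝ → F}
    (h : SpatiallyContDiff tEnd n f) : SliceContDiff (Ico 0 tEnd) n f := by
  induction n generalizing f with
  | zero => simpa [SliceContDiff] using h.2 0 le_rfl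
  | succ n ih =>
    have hd : ∀ t ∈ Ico 0 tEnd, Differentiable ℝ (f t) ∧ ContDiff ℝ n (deriv (f t)) :=
      fun t ht => by
        have := contDiff_succ_iff_deriv.1 (by exact_mod_cast h.1 t ht : ContDiff ℝ (n + 1) (f t))
        exact ⟨this.1, this.2.2⟩
    refine ⟨by simpa using h.2 0 (Nat.zero_le _), fun t ht => (hd t ht).1,
      ih ⟨fun t ht => (hd t ht).2, fun k hk => ?_⟩⟩
    simpa only [iteratedDeriv_succ'] using h.2 (k + 1) (by omega)

end SliceContDiff

/-! ### Parametric integrals, commuting derivatives and conservation laws. -/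

section TimeDerivatives

open MeasureTheory Filter Topology

variable {F : Type*} [NormedAddCommGroup F] [NormedSpace ℝ F]

theorem hasDerivAt_integral_of_continuousOn {a b : ℝ} (hab : a ≤ b) {f f' : ℝ → ℝ → F}
    (hf : ContinuousOn (fun p : ℝ × ℝ => f p.1 p.2) (Icc a b ×ˢ univ))
    (hf' : ContinuousOn (fun p : ℝ × ℝ => f' p.1 p.2) (Icc a b ×ˢ univ))
    (hderiv : ∀ r ∈ Icc a b, ∀ u, HasDerivAt (f r) (f' r u) u) (u : ℝ) :
    HasDerivAt (fun v => ∫ r in a..b, f r v) (∫ r in a..b, f' r u) u := by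
  have hslice : ∀ {h : ℝ → ℝ → F},
      ContinuousOn (fun p : ℝ × ℝ => h p.1 p.2) (Icc a b ×ˢ univ) →
      ∀ v, IntervalIntegrable (fun r => h r v) volume a b := fun hh v => by
    apply ContinuousOn.intervalIntegrable_of_Icc hab
    exact hh.comp (by fun_prop : ContinuousOn (fun r : ℝ => (r, v)) (Icc a b))
      fun r hr => ⟨hr, mem_univ v⟩
  obtain ⟨C, hC⟩ := (isCompact_Icc.prod (isCompact_closedBall u 1)).exists_bound_of_continuousOn
    (hf'.mono (prod_mono_right (subset_univ (Metric.closedBall u 1))))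
  refine (intervalIntegral.hasDerivAt_integral_of_dominated_loc_of_deriv_le
    (F := fun v r => f r v) (F' := fun v r => f' r v) (bound := fun _ => C)
    (Metric.closedBall_mem_nhds u one_pos)
    (Eventually.of_forall fun v => (intervalIntegrable_iff.1 (hslice hf v)).aestronglyMeasurable)
    (hslice hf u) (intervalIntegrable_iff.1 (hslice hf' u)).aestronglyMeasurable ?_
    intervalIntegrable_const ?_).2
  · refine Eventually.of_forall fun r hr v hv => hC (r, v) ⟨?_, hv⟩
    exact Ioc_subset_Icc_self (by rwa [uIoc_of_le hab] at hr)
  · refine Eventually.of_forall fun r hr v _ => hderiv r ?_ v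
    exact Ioc_subset_Icc_self (by rwa [uIoc_of_le hab] at hr)

theorem integral_eq_sub_of_evolution [CompleteSpace F] {tEnd : ℝ} {f V : ℝ → ℝ → F}
    (hf : ContinuousOn (fun p : ℝ × ℝ => f p.1 p.2) (Ico 0 tEnd ×ˢ univ))
    (hV : ContinuousOn (fun p : ℝ × ℝ => V p.1 p.2) (Ico 0 tEnd ×ˢ univ))
    (hderiv : ∀ t ∈ Ioo 0 tEnd, ∀ u, HasDerivAt (fun r => f r u) (V t u) t)
    {t : ℝ} (ht : t ∈ Ico 0 tEnd) (u : ℝ) : ∫ r in (0 : ℝ)..t, V r u = f t u - f 0 u := by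
  have hsub : Icc 0 t ⊆ Ico 0 tEnd := fun r hr => ⟨hr.1, hr.2.trans_lt ht.2⟩
  have hslice : ∀ {h : ℝ → ℝ → F},
      ContinuousOn (fun p : ℝ × ℝ => h p.1 p.2) (Ico 0 tEnd ×ˢ univ) →
      ContinuousOn (fun r => h r u) (Icc 0 t) := fun hh =>
    hh.comp (by fun_prop : ContinuousOn (fun r : ℝ => (r, u)) (Icc 0 t))
      fun r hr => ⟨hsub hr, mem_univ u⟩
  exact intervalIntegral.integral_eq_sub_of_hasDerivAt_of_le ht.1 (hslice hf)
    (fun r hr => hderiv r ⟨hr.1, hr.2.trans ht.2⟩ u)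
    ((hslice hV).intervalIntegrable_of_Icc ht.1)

/-- Differentiation in time and in space commute. -/
theorem SliceContDiff.hasDerivAt_deriv_of_evolution [CompleteSpace F] {tEnd : ℝ} {f V : ℝ → ℝ → F}
    (hf : SliceContDiff (Ico 0 tEnd) 1 f) (hV : SliceContDiff (Ico 0 tEnd) 1 V)
    (hderiv : ∀ t ∈ Ioo 0 tEnd, ∀ u, HasDerivAt (fun r => f r u) (V t u) t) :
    ∀ t ∈ Ioo 0 tEnd, ∀ u, HasDerivAt (fun r => _root_.deriv (f r) u) (_root_.deriv (V t) u) t := by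
  intro t ht u
  have h0 : (0 : ℝ) ∈ Ico 0 tEnd := ⟨le_rfl, ht.1.trans ht.2⟩
  -- Differentiate f r = f 0 + ∫ V in u under the integral sign; the fundamental theorem of calculus
  -- in r then gives the claim without any mixed second derivative being assumed.
  have hformula : ∀ r ∈ Ioo 0 tEnd, _root_.deriv (f r) u =
      _root_.deriv (f 0) u + ∫ q in (0 : ℝ)..r, _root_.deriv (V q) u := fun r hr => by
    have hr' := Ioo_subset_Ico_self hr
    have hsub : Icc 0 r ⊆ Ico 0 tEnd := fun q hq => ⟨hq.1, hq.2.trans_lt hr.2⟩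
    have h1 := hasDerivAt_integral_of_continuousOn hr.1.le
      (hV.continuousOn.mono (prod_mono_left hsub)) (hV.deriv.continuousOn.mono (prod_mono_left hsub))
      (fun q hq v => hV.hasDerivAt (hsub hq) v) u
    have h2 := (hf.hasDerivAt hr' u).sub (hf.hasDerivAt h0 u)
    have h3 : (fun v => ∫ q in (0 : ℝ)..r, V q v) = f r - f 0 :=
      funext fun v => integral_eq_sub_of_evolution hf.continuousOn hV.continuousOn hderiv hr' v
    rw [h3] at h1
    rw [h1.unique h2]
    abel
  have hcont : ContinuousOn (fun r => _root_.deriv (V r) u) (Ico 0 tEnd) :=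
    hV.deriv.continuousOn.comp (by fun_prop : ContinuousOn (fun r : ℝ => (r, u)) (Ico 0 tEnd))
      fun r hr => ⟨hr, mem_univ u⟩
  have hat : ContinuousAt (fun r => _root_.deriv (V r) u) t :=
    hcont.continuousAt (Ico_mem_nhds ht.1 ht.2)
  refine HasDerivAt.congr_of_eventuallyEq ?_
    (eventually_of_mem (Ioo_mem_nhds ht.1 ht.2) hformula)
  refine HasDerivAt.const_add _ (intervalIntegral.integral_hasDerivAt_right ?_ ?_ hat)
  · exact (hcont.mono fun q hq => ⟨hq.1, hq.2.trans_lt ht.2⟩).intervalIntegrable_of_Icc ht.1.le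
  · exact (hcont.mono Ioo_subset_Ico_self).stronglyMeasurableAtFilter isOpen_Ioo t ht

/-- A density evolving by the derivative of a flux that is periodic has constant total mass. -/
theorem integral_eq_of_evolution_deriv {tEnd a b : ℝ} {f w : ℝ → ℝ → ℝ}
    (hf : SliceContDiff (Ico 0 tEnd) 0 f) (hw : SliceContDiff (Ico 0 tEnd) 1 w)
    (hderiv : ∀ t ∈ Ioo 0 tEnd, ∀ u, HasDerivAt (fun r => f r u) (deriv (w t) u) t)
    (hper : ∀ t ∈ Ico 0 tEnd, w t a = w t b) {t : ℝ} (ht : t ∈ Ico 0 tEnd) :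
    ∫ u in a..b, f t u = ∫ u in a..b, f 0 u := by
  have h0 : (0 : ℝ) ∈ Ico 0 tEnd := ⟨le_rfl, ht.1.trans_lt ht.2⟩
  rw [← sub_eq_zero, ← intervalIntegral.integral_sub ((hf.continuous ht).intervalIntegrable _ _)
    ((hf.continuous h0).intervalIntegrable _ _)]
  -- The change of mass becomes a double integral of ∂ᵤw. After Fubini the inner integral is w t b -
  -- w t a = 0.
  simp_rw [← integral_eq_sub_of_evolution hf.continuousOn hw.deriv.continuousOn hderiv ht]
  have hsub : uIcc 0 t ⊆ Ico 0 tEnd := by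
    rw [uIcc_of_le ht.1]
    exact fun r hr => ⟨hr.1, hr.2.trans_lt ht.2⟩
  rw [intervalIntegral_intervalIntegral_swap]
  · refine (intervalIntegral.integral_congr fun r hr => ?_).trans intervalIntegral.integral_zero
    rw [intervalIntegral.integral_eq_sub_of_hasDerivAt
      (fun u _ => hw.hasDerivAt (hsub hr) u)
      ((hw.deriv.continuous (hsub hr)).intervalIntegrable _ _), hper r (hsub hr), sub_self]
  · refine (ContinuousOn.integrableOn_compact (isCompact_uIcc.prod isCompact_uIcc) ?_).mono_set
      (prod_mono uIoc_subset_uIcc uIoc_subset_uIcc)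
    exact hw.deriv.continuousOn.comp continuous_swap.continuousOn
      fun p hp => ⟨hsub hp.2, mem_univ p.1⟩

end TimeDerivatives

/-! ### Orthonormal frames from the vector product. -/

section Frame

/-- The vector product as a continuous bilinear map. -/
def crossCLM : E3 →L[ℝ] E3 →L[ℝ] E3 :=
  LinearMap.toContinuousLinearMap ((LinearMap.toContinuousLinearMap :
    (E3 →ₗ[ℝ] E3) ≃ₗ[ℝ] (E3 →L[ℝ] E3)).toLinearMap ∘ₗ
    LinearMap.mk₂ ℝ cross (by intros; simp [cross]) (by intros; simp [cross])
      (by intros; simp [cross]) (by intros; simp [cross]))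

theorem inner_cross_left (a b : E3) : ⟪cross a b, a⟫ = 0 := by
  simp [cross, PiLp.inner_apply, Fin.sum_univ_three, cross_apply]; ring

theorem inner_cross_right (a b : E3) : ⟪cross a b, b⟫ = 0 := by
  simp [cross, PiLp.inner_apply, Fin.sum_univ_three, cross_apply]; ring

theorem inner_cross_self (a b : E3) :
    ⟪cross a b, cross a b⟫ = ⟪a, a⟫ * ⟪b, b⟫ - ⟪a, b⟫ ^ 2 := by
  simp only [cross, PiLp.inner_apply, Fin.sum_univ_three, cross_apply]
  simp
  ring

theorem eq_frame_combination {a b : E3} (ha : ⟪a, a⟫ = 1) (hb : ⟪b, b⟫ = 1) (hab : ⟪a, b⟫ = 0)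
    (x : E3) : x = ⟪x, a⟫ • a + ⟪x, b⟫ • b + ⟪x, cross a b⟫ • cross a b := by
  have hc : ⟪cross a b, cross a b⟫ = 1 := by rw [inner_cross_self, ha, hb, hab]; norm_num
  have ho : Orthonormal ℝ ![a, b, cross a b] := by
    have hn : ∀ y : E3, ⟪y, y⟫ = 1 → ‖y‖ = 1 := fun y hy => by
      rw [norm_eq_sqrt_real_inner, hy, Real.sqrt_one]
    refine ⟨fun i => ?_, fun i j hij => ?_⟩
    · fin_cases i
      exacts [hn _ ha, hn _ hb, hn _ hc]
    · have h1 := inner_cross_left a b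
      have h2 := inner_cross_right a b
      fin_cases i <;> fin_cases j <;>
        first
          | exact absurd rfl hij
          | simpa [real_inner_comm] using hab
          | simpa [real_inner_comm] using h1
          | simpa [real_inner_comm] using h2
  have hspan := (basisOfOrthonormalOfCardEqFinrank ho (by simp)).span_eq
  rw [coe_basisOfOrthonormalOfCardEqFinrank] at hspan
  have := (OrthonormalBasis.mk ho hspan.ge).sum_repr' x
  simp only [OrthonormalBasis.coe_mk, Fin.sum_univ_three] at this
  simpa [real_inner_comm] using this.symm

end Frame

/-! ### Arclength derivatives and the Frenet equations. -/

section FrenetEquations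

variable {F : Type*} [NormedAddCommGroup F] [NormedSpace ℝ F] {c : ℝ → E3} {φ : ℝ → ℝ} {u : ℝ}

theorem speed_ne_zero (hreg : deriv c u ≠ 0) : speed c u ≠ 0 := norm_ne_zero_iff.2 hreg

theorem speed_smul_arcDeriv (hreg : deriv c u ≠ 0) (f : ℝ → F) :
    speed c u • arcDeriv c f u = deriv f u :=
  smul_inv_smul₀ (speed_ne_zero hreg) _

theorem hasDerivAt_speed_smul_arcDeriv (hreg : deriv c u ≠ 0) {f : ℝ → F}
    (hf : DifferentiableAt ℝ f u) : HasDerivAt f (speed c u • arcDeriv c f u) u := by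
  rw [speed_smul_arcDeriv hreg]; exact hf.hasDerivAt

theorem arcDeriv_eq_of_hasDerivAt (hreg : deriv c u ≠ 0) {f : ℝ → F} {f' : F}
    (hf : HasDerivAt f (speed c u • f') u) : arcDeriv c f u = f' := by
  rw [arcDeriv, hf.deriv, inv_smul_smul₀ (speed_ne_zero hreg)]

theorem hasDerivAt_speed (hreg : deriv c u ≠ 0) (hc : DifferentiableAt ℝ (deriv c) u) :
    HasDerivAt (speed c) (⟪deriv c u, deriv (deriv c) u⟫ * (speed c u)⁻¹) u :=
  hasDerivAt_norm_of_ne_zero hc.hasDerivAt hreg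

/-- With f = c this expresses ∂ₛT through ∂ᵤc and ∂ᵤ²c alone, which is the form that can be
differentiated in time. -/
theorem arcDeriv_arcDeriv (hreg : deriv c u ≠ 0) (hc : DifferentiableAt ℝ (deriv c) u)
    {f : ℝ → F} (hf : DifferentiableAt ℝ (deriv f) u) :
    arcDeriv c (arcDeriv c f) u = ((speed c u)⁻¹ ^ 2) • deriv (deriv f) u
      - (⟪deriv c u, deriv (deriv c) u⟫ * (speed c u)⁻¹ ^ 4) • deriv f u := by
  have hg := speed_ne_zero hreg
  have h : HasDerivAt (arcDeriv c f) _ u :=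
    ((hasDerivAt_speed hreg hc).fun_inv hg).smul hf.hasDerivAt
  rw [arcDeriv, h.deriv, smul_add, smul_smul, smul_smul, sub_eq_add_neg, ← neg_smul]
  congr 2
  · ring
  · field_simp

theorem inner_tangent_self (hreg : deriv c u ≠ 0) : ⟪tangent c u, tangent c u⟫ = 1 := by
  have hg := speed_ne_zero hreg
  rw [tangent, arcDeriv, real_inner_smul_left, real_inner_smul_right, real_inner_self_eq_norm_sq,
    ← speed]
  field_simp

theorem inner_normal_self (hκ : curvature c u ≠ 0) : ⟪normal c u, normal c u⟫ = 1 := by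
  rw [normal, real_inner_smul_left, real_inner_smul_right, real_inner_self_eq_norm_sq,
    ← curvature]
  field_simp

theorem curvature_smul_normal (hκ : curvature c u ≠ 0) :
    curvature c u • normal c u = arcDeriv c (tangent c) u :=
  smul_inv_smul₀ hκ _

theorem inner_self_deriv_eq_zero {E : Type*} [NormedAddCommGroup E] [InnerProductSpace ℝ E]
    {f : ℝ → E} {f' : E} {a : ℝ} (hf : HasDerivAt f f' u) (h : ∀ v, ⟪f v, f v⟫ = a) :
    ⟪f u, f'⟫ = 0 := by
  have h1 := hf.inner ℝ hf
  have h2 : (fun v => ⟪f v, f v⟫) = fun _ => a := funext h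
  rw [h2] at h1
  have := h1.unique (hasDerivAt_const u a)
  rw [real_inner_comm (f u) f'] at this
  linarith

theorem inner_deriv_add_eq_zero {E : Type*} [NormedAddCommGroup E] [InnerProductSpace ℝ E]
    {f g : ℝ → E} {f' g' : E} {a : ℝ} (hf : HasDerivAt f f' u) (hg : HasDerivAt g g' u)
    (h : ∀ v, ⟪f v, g v⟫ = a) : ⟪f u, g'⟫ + ⟪f', g u⟫ = 0 := by
  have h1 := hf.inner ℝ hg
  have h2 : (fun v => ⟪f v, g v⟫) = fun _ => a := funext h
  rw [h2] at h1
  exact h1.unique (hasDerivAt_const u a)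

/-- A regular curve without inflection points whose Frenet frame is differentiable. -/
structure IsFrenetCurve (c : ℝ → E3) : Prop where
  regular : ∀ u, deriv c u ≠ 0
  curvature_ne_zero : ∀ u, curvature c u ≠ 0
  differentiable_deriv : Differentiable ℝ (deriv c)
  differentiable_tangent : Differentiable ℝ (tangent c)
  differentiable_normal : Differentiable ℝ (normal c)

namespace IsFrenetCurve

theorem inner_tangent_normal (hc : IsFrenetCurve c) (u : ℝ) : ⟪tangent c u, normal c u⟫ = 0 := by
  rw [normal, arcDeriv, real_inner_smul_right, real_inner_smul_right,
    inner_self_deriv_eq_zero (hc.differentiable_tangent u).hasDerivAt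
      fun v => inner_tangent_self (hc.regular v), mul_zero, mul_zero]

theorem inner_tangent_binormal (u : ℝ) : ⟪tangent c u, binormal c u⟫ = 0 := by
  rw [real_inner_comm, binormal, inner_cross_left]

theorem inner_normal_binormal (u : ℝ) : ⟪normal c u, binormal c u⟫ = 0 := by
  rw [real_inner_comm, binormal, inner_cross_right]

theorem inner_normal_tangent (hc : IsFrenetCurve c) (u : ℝ) : ⟪normal c u, tangent c u⟫ = 0 := by
  rw [real_inner_comm, hc.inner_tangent_normal]

theorem inner_binormal_tangent (u : ℝ) : ⟪binormal c u, tangent c u⟫ = 0 :=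
  inner_cross_left _ _

theorem inner_binormal_normal (u : ℝ) : ⟪binormal c u, normal c u⟫ = 0 :=
  inner_cross_right _ _

theorem inner_binormal_self (hc : IsFrenetCurve c) (u : ℝ) :
    ⟪binormal c u, binormal c u⟫ = 1 := by
  rw [binormal, inner_cross_self, inner_tangent_self (hc.regular u),
    inner_normal_self (hc.curvature_ne_zero u), hc.inner_tangent_normal u]
  norm_num

theorem hasDerivAt_tangent (hc : IsFrenetCurve c) (u : ℝ) :
    HasDerivAt (tangent c) (speed c u • curvature c u • normal c u) u := by
  rw [curvature_smul_normal (hc.curvature_ne_zero u)]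
  exact hasDerivAt_speed_smul_arcDeriv (hc.regular u) (hc.differentiable_tangent u)

theorem eq_frenet_combination (hc : IsFrenetCurve c) (u : ℝ) (x : E3) :
    x = ⟪x, tangent c u⟫ • tangent c u + ⟪x, normal c u⟫ • normal c u
      + ⟪x, binormal c u⟫ • binormal c u :=
  eq_frame_combination (inner_tangent_self (hc.regular u))
    (inner_normal_self (hc.curvature_ne_zero u)) (hc.inner_tangent_normal u) x

/-- Differentiating ⟨N, N⟩ = 1 and ⟨T, N⟩ = 0 fixes the components along N and T; the one along B is
the torsion by definition. -/
theorem hasDerivAt_normal (hc : IsFrenetCurve c) (u : ℝ) :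
    HasDerivAt (normal c) (speed c u •
      (-(curvature c u) • tangent c u + torsion c u • binormal c u)) u := by
  have h := hasDerivAt_speed_smul_arcDeriv (hc.regular u) (hc.differentiable_normal u)
  have hg := speed_ne_zero (hc.regular u)
  have hNN := inner_self_deriv_eq_zero h fun v => inner_normal_self (hc.curvature_ne_zero v)
  have hTN := inner_deriv_add_eq_zero (hc.hasDerivAt_tangent u) h hc.inner_tangent_normal
  rw [real_inner_smul_right, mul_eq_zero, or_iff_right hg] at hNN
  rw [real_inner_smul_right, real_inner_smul_left, real_inner_smul_left,
    inner_normal_self (hc.curvature_ne_zero u), ← mul_add, mul_eq_zero, or_iff_right hg] at hTN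
  refine h.congr_deriv (congrArg _ ?_)
  rw [hc.eq_frenet_combination u (arcDeriv c (normal c) u), real_inner_comm (tangent c u),
    real_inner_comm (normal c u), hNN, eq_neg_of_add_eq_zero_left hTN, torsion]
  simp

theorem hasDerivAt_binormal (hc : IsFrenetCurve c) (u : ℝ) :
    HasDerivAt (binormal c) (speed c u • -(torsion c u) • normal c u) u := by
  -- The product rule serves only for differentiability; the components come from the orthonormality
  -- relations.
  have h : HasDerivAt (binormal c) _ u := crossCLM.hasDerivAt_of_bilinear
    (fun _ => hc.hasDerivAt_tangent u) (fun _ => hc.hasDerivAt_normal u)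
  have hB := hasDerivAt_speed_smul_arcDeriv (hc.regular u) h.differentiableAt
  have hg := speed_ne_zero (hc.regular u)
  have hBB := inner_self_deriv_eq_zero hB hc.inner_binormal_self
  have hTB := inner_deriv_add_eq_zero (hc.hasDerivAt_tangent u) hB inner_tangent_binormal
  have hNB := inner_deriv_add_eq_zero (hc.hasDerivAt_normal u) hB inner_normal_binormal
  simp only [real_inner_smul_right, real_inner_smul_left, inner_add_left, ← mul_add, mul_eq_zero,
    hg, false_or, inner_tangent_binormal, inner_normal_binormal, hc.inner_binormal_self u,
    mul_zero, add_zero, mul_one, zero_add] at hBB hTB hNB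
  refine hB.congr_deriv (congrArg _ ?_)
  rw [hc.eq_frenet_combination u (arcDeriv c (binormal c) u), real_inner_comm (tangent c u), hTB,
    real_inner_comm (normal c u), eq_neg_of_add_eq_zero_left hNB, real_inner_comm (binormal c u),
    hBB]
  simp

/-- The tangential, normal and binormal components of a field along the curve change along the
curve according to the Frenet equations. -/
theorem hasDerivAt_combination (hc : IsFrenetCurve c) {p q r : ℝ → ℝ} {p' q' r' : ℝ}
    (hp : HasDerivAt p (speed c u * p') u) (hq : HasDerivAt q (speed c u * q') u)
    (hr : HasDerivAt r (speed c u * r') u) :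
    HasDerivAt (fun v => p v • tangent c v + q v • normal c v + r v • binormal c v)
      (speed c u • ((p' - curvature c u * q u) • tangent c u
        + (q' + curvature c u * p u - torsion c u * r u) • normal c u
        + (r' + torsion c u * q u) • binormal c u)) u := by
  refine (((hp.smul (hc.hasDerivAt_tangent u)).add (hq.smul (hc.hasDerivAt_normal u))).add
    (hr.smul (hc.hasDerivAt_binormal u))).congr_deriv ?_
  module

/-- First arclength derivative of the velocity of the framed curvature flow. -/
theorem arcDeriv_velocity (hc : IsFrenetCurve c) (hκ : DifferentiableAt ℝ (curvature c) u)
    (hφ : DifferentiableAt ℝ φ u) :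
    arcDeriv c (fun v => curvature c v • thetaNormal c φ v) u =
      (-(curvature c u * psiOne c φ u)) • tangent c u
      + (arcDeriv c (curvature c) u * Real.cos (φ u) - psiTwo c φ u * psiThree c φ u) • normal c u
      + (arcDeriv c (curvature c) u * Real.sin (φ u) + psiOne c φ u * psiThree c φ u) •
        binormal c u := by
  have h1 := hasDerivAt_speed_smul_arcDeriv (hc.regular u) hκ
  have h2 := hasDerivAt_speed_smul_arcDeriv (hc.regular u) hφ
  have hV : (fun v => curvature c v • thetaNormal c φ v) = fun v => (0 : ℝ) • tangent c v
      + psiOne c φ v • normal c v + psiTwo c φ v • binormal c v := by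
    funext v
    simp only [thetaNormal, psiOne, psiTwo]
    module
  -- In the frame, V = 0·T + ψ₁N + ψ₂B; the torsion terms then join ∂ₛθ to form ψ₃.
  rw [hV]
  refine (arcDeriv_eq_of_hasDerivAt (hc.regular u) (hc.hasDerivAt_combination
    (p' := 0) (q' := arcDeriv c (curvature c) u * Real.cos (φ u)
      - psiTwo c φ u * arcDeriv c φ u)
    (r' := arcDeriv c (curvature c) u * Real.sin (φ u) + psiOne c φ u * arcDeriv c φ u)
    ?_ ?_ ?_)).trans ?_
  · simpa using hasDerivAt_const u (0 : ℝ)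
  · refine (h1.mul h2.cos).congr_deriv ?_
    simp only [psiTwo, smul_eq_mul]
    ring
  · refine (h1.mul h2.sin).congr_deriv ?_
    simp only [psiOne, smul_eq_mul]
    ring
  · simp only [psiThree]
    module

theorem inner_arcDeriv_velocity_tangent (hc : IsFrenetCurve c)
    (hκ : DifferentiableAt ℝ (curvature c) u) (hφ : DifferentiableAt ℝ φ u) :
    ⟪arcDeriv c (fun v => curvature c v • thetaNormal c φ v) u, tangent c u⟫ =
      -(curvature c u * psiOne c φ u) := by
  rw [hc.arcDeriv_velocity hκ hφ]
  simp only [inner_add_left, real_inner_smul_left, inner_tangent_self (hc.regular u),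
    hc.inner_normal_tangent, inner_binormal_tangent]
  ring

theorem inner_arcDeriv_arcDeriv_velocity_normal (hc : IsFrenetCurve c)
    (hκ : Differentiable ℝ (curvature c)) (hφ : Differentiable ℝ φ)
    (hκ' : DifferentiableAt ℝ (arcDeriv c (curvature c)) u)
    (hψ : DifferentiableAt ℝ (psiThree c φ) u) :
    ⟪arcDeriv c (arcDeriv c (fun v => curvature c v • thetaNormal c φ v)) u, normal c u⟫ =
      (arcDeriv c (arcDeriv c (curvature c)) u - curvature c u * psiThree c φ u ^ 2)
          * Real.cos (φ u)
      - (2 * arcDeriv c (curvature c) u * psiThree c φ u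
          + curvature c u * arcDeriv c (psiThree c φ) u) * Real.sin (φ u)
      - curvature c u ^ 2 * psiOne c φ u := by
  have h1 := hasDerivAt_speed_smul_arcDeriv (hc.regular u) (hκ u)
  have h2 := hasDerivAt_speed_smul_arcDeriv (hc.regular u) (hφ u)
  have h3 := hasDerivAt_speed_smul_arcDeriv (hc.regular u) hκ'
  have h4 := hasDerivAt_speed_smul_arcDeriv (hc.regular u) hψ
  have hp : HasDerivAt (fun v => -(curvature c v * psiOne c φ v)) _ u :=
    (h1.mul (h1.mul h2.cos)).neg
  have hq : HasDerivAt (fun v => arcDeriv c (curvature c) v * Real.cos (φ v)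
      - psiTwo c φ v * psiThree c φ v) _ u := (h3.mul h2.cos).sub ((h1.mul h2.sin).mul h4)
  have hr : HasDerivAt (fun v => arcDeriv c (curvature c) v * Real.sin (φ v)
      + psiOne c φ v * psiThree c φ v) _ u := (h3.mul h2.sin).add ((h1.mul h2.cos).mul h4)
  have hg := speed_ne_zero (hc.regular u)
  -- Puts the raw u-derivatives into the form g · p' that `hasDerivAt_combination` expects.
  have hscale : ∀ x, speed c u * ((speed c u)⁻¹ * x) = x := mul_inv_cancel_left₀ hg
  have hV : arcDeriv c (fun v => curvature c v • thetaNormal c φ v) = _ :=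
    funext fun v => hc.arcDeriv_velocity (hκ v) (hφ v)
  rw [hV, arcDeriv_eq_of_hasDerivAt (hc.regular u) (hc.hasDerivAt_combination
      (hp.congr_deriv (hscale _).symm) (hq.congr_deriv (hscale _).symm)
      (hr.congr_deriv (hscale _).symm))]
  simp only [inner_add_left, real_inner_smul_left, hc.inner_tangent_normal,
    inner_normal_self (hc.curvature_ne_zero u), inner_binormal_normal]
  simp only [smul_eq_mul, psiOne, psiTwo, psiThree, Pi.mul_apply]
  field_simp
  ring

end IsFrenetCurve

end FrenetEquations

/-! ### Evolution of speed and curvature under a general velocity. -/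

section Evolution

open Filter Topology

variable {γ : ℝ → ℝ → E3} {V : ℝ → E3} {t u : ℝ}

theorem hasDerivAt_speed_of_evolution (hreg : deriv (γ t) u ≠ 0)
    (h1 : HasDerivAt (fun r => deriv (γ r) u) (deriv V u) t) :
    HasDerivAt (fun r => speed (γ r) u)
      (speed (γ t) u * ⟪arcDeriv (γ t) V u, tangent (γ t) u⟫) t := by
  have hg := speed_ne_zero hreg
  refine (hasDerivAt_norm_of_ne_zero h1 hreg).congr_deriv ?_
  rw [tangent, arcDeriv, arcDeriv, real_inner_smul_left, real_inner_smul_right, ← speed,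
    real_inner_comm]
  field_simp

/-- Since κ = ‖∂ₛT‖, its rate is ⟨∂ₜ∂ₛT, N⟩, so N is never differentiated in time. Multiples of ∂ᵤγ
vanish against N, and the factor g⁻² produces -2κ⟨∂ₛV, T⟩. -/
theorem hasDerivAt_curvature_of_evolution
    (hreg : ∀ᶠ r in 𝓝 t, deriv (γ r) u ≠ 0)
    (hdiff : ∀ᶠ r in 𝓝 t, DifferentiableAt ℝ (deriv (γ r)) u)
    (hc : IsFrenetCurve (γ t)) (hV : DifferentiableAt ℝ (deriv V) u)
    (h1 : HasDerivAt (fun r => deriv (γ r) u) (deriv V u) t)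
    (h2 : HasDerivAt (fun r => deriv (deriv (γ r)) u) (deriv (deriv V) u) t) :
    HasDerivAt (fun r => curvature (γ r) u)
      (⟪arcDeriv (γ t) (arcDeriv (γ t) V) u, normal (γ t) u⟫
        - 2 * curvature (γ t) u * ⟪arcDeriv (γ t) V u, tangent (γ t) u⟫) t := by
  have hg := speed_ne_zero (hc.regular u)
  have hk := hc.curvature_ne_zero u
  have hg' := (hasDerivAt_speed_of_evolution (hc.regular u) h1).fun_inv hg
  have hA : HasDerivAt (fun r => arcDeriv (γ r) (tangent (γ r)) u) _ t :=
    (((hg'.fun_pow 2).smul h2).sub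
      (((h1.inner ℝ h2).mul (hg'.fun_pow 4)).smul h1)).congr_of_eventuallyEq (by
        filter_upwards [hreg, hdiff] with r hr hr'
        exact arcDeriv_arcDeriv hr hr' hr')
  have hA0 : arcDeriv (γ t) (tangent (γ t)) u ≠ 0 := norm_ne_zero_iff.1 hk
  refine (hasDerivAt_norm_of_ne_zero hA hA0).congr_deriv ?_
  have hxN : ⟪deriv (γ t) u, normal (γ t) u⟫ = 0 := by
    rw [← speed_smul_arcDeriv (hc.regular u), real_inner_smul_left]
    exact mul_eq_zero_of_right _ (hc.inner_tangent_normal u)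
  have hAN : ⟪arcDeriv (γ t) (tangent (γ t)) u, normal (γ t) u⟫ = curvature (γ t) u := by
    rw [← curvature_smul_normal hk, real_inner_smul_left, inner_normal_self hk, mul_one]
  -- Reduces `hAN` to g⁻²⟨∂ᵤ²γ, N⟩ = κ, the only place where κ meets ∂ᵤ²γ.
  rw [show arcDeriv (γ t) (tangent (γ t)) u = _ from
    arcDeriv_arcDeriv (hc.regular u) hc.differentiable_deriv.differentiableAt
      hc.differentiable_deriv.differentiableAt, inner_sub_left, real_inner_smul_left,
      real_inner_smul_left, hxN, mul_zero, sub_zero] at hAN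
  rw [show ‖arcDeriv (γ t) (tangent (γ t)) u‖ = curvature (γ t) u from rfl,
    ← curvature_smul_normal hk, real_inner_smul_left, mul_comm,
    inv_mul_cancel_left₀ hk, real_inner_comm,
    arcDeriv_arcDeriv (hc.regular u) hc.differentiable_deriv.differentiableAt hV]
  simp only [inner_add_left, inner_sub_left, real_inner_smul_left, hxN, Pi.mul_apply,
    Nat.reduceSub, pow_one]
  rw [← hAN]
  field_simp
  ring

end Evolution

/-! ### Regularity of the geometric quantities: orders of differentiability lost. -/

section Regularity

variable {I : Set ℝ} {γ : ℝ → ℝ → E3} {θ : ℝ → ℝ → ℝ} {n : ℕ}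

namespace SliceContDiff

theorem speed (hγ : SliceContDiff I (n + 1) γ) (hreg : ∀ t ∈ I, ∀ u, _root_.deriv (γ t) u ≠ 0) :
    SliceContDiff I n (fun t => speed (γ t)) :=
  hγ.deriv.norm hreg

theorem arcDeriv {F : Type*} [NormedAddCommGroup F] [NormedSpace ℝ F] {f : ℝ → ℝ → F}
    (hf : SliceContDiff I (n + 1) f) (hγ : SliceContDiff I (n + 1) γ)
    (hreg : ∀ t ∈ I, ∀ u, _root_.deriv (γ t) u ≠ 0) :
    SliceContDiff I n (fun t => arcDeriv (γ t) (f t)) :=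
  ((hγ.speed hreg).inv fun t ht u => speed_ne_zero (hreg t ht u)).smul hf.deriv

theorem tangent (hγ : SliceContDiff I (n + 1) γ)
    (hreg : ∀ t ∈ I, ∀ u, _root_.deriv (γ t) u ≠ 0) : SliceContDiff I n (fun t => tangent (γ t)) :=
  hγ.arcDeriv hγ hreg

theorem curvature (hγ : SliceContDiff I (n + 2) γ)
    (hreg : ∀ t ∈ I, ∀ u, _root_.deriv (γ t) u ≠ 0)
    (hκ : ∀ t ∈ I, ∀ u, FramedCurve.curvature (γ t) u ≠ 0) :
    SliceContDiff I n (fun t => curvature (γ t)) :=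
  ((hγ.tangent hreg).arcDeriv hγ.of_succ hreg).norm fun t ht u => norm_ne_zero_iff.1 (hκ t ht u)

theorem normal (hγ : SliceContDiff I (n + 2) γ)
    (hreg : ∀ t ∈ I, ∀ u, _root_.deriv (γ t) u ≠ 0)
    (hκ : ∀ t ∈ I, ∀ u, FramedCurve.curvature (γ t) u ≠ 0) :
    SliceContDiff I n (fun t => normal (γ t)) :=
  ((hγ.curvature hreg hκ).inv hκ).smul ((hγ.tangent hreg).arcDeriv hγ.of_succ hreg)

theorem binormal (hγ : SliceContDiff I (n + 2) γ)
    (hreg : ∀ t ∈ I, ∀ u, _root_.deriv (γ t) u ≠ 0)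
    (hκ : ∀ t ∈ I, ∀ u, FramedCurve.curvature (γ t) u ≠ 0) :
    SliceContDiff I n (fun t => binormal (γ t)) :=
  bilinear crossCLM (hγ.of_succ.tangent hreg) (hγ.normal hreg hκ)

theorem psiThree (hγ : SliceContDiff I (n + 3) γ) (hθ : SliceContDiff I (n + 1) θ)
    (hreg : ∀ t ∈ I, ∀ u, _root_.deriv (γ t) u ≠ 0)
    (hκ : ∀ t ∈ I, ∀ u, FramedCurve.curvature (γ t) u ≠ 0) :
    SliceContDiff I n (fun t => psiThree (γ t) (θ t)) :=
  (((hγ.normal hreg hκ).arcDeriv hγ.of_succ.of_succ hreg).inner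
    (hγ.of_succ.binormal hreg hκ)).add (hθ.arcDeriv hγ.of_succ.of_succ hreg)

theorem velocity (hγ : SliceContDiff I (n + 2) γ) (hθ : SliceContDiff I n θ)
    (hreg : ∀ t ∈ I, ∀ u, _root_.deriv (γ t) u ≠ 0)
    (hκ : ∀ t ∈ I, ∀ u, FramedCurve.curvature (γ t) u ≠ 0) :
    SliceContDiff I n (fun t u => FramedCurve.curvature (γ t) u • thetaNormal (γ t) (θ t) u) :=
  (hγ.curvature hreg hκ).smul ((hθ.cos_sin.1.smul (hγ.normal hreg hκ)).add
    (hθ.cos_sin.2.smul (hγ.binormal hreg hκ)))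

theorem isFrenetCurve (hγ : SliceContDiff I 3 γ)
    (hreg : ∀ t ∈ I, ∀ u, _root_.deriv (γ t) u ≠ 0)
    (hκ : ∀ t ∈ I, ∀ u, FramedCurve.curvature (γ t) u ≠ 0) {t : ℝ} (ht : t ∈ I) :
    IsFrenetCurve (γ t) where
  regular := hreg t ht
  curvature_ne_zero := hκ t ht
  differentiable_deriv u := (hγ.deriv.hasDerivAt ht u).differentiableAt
  differentiable_tangent u := ((hγ.tangent hreg).hasDerivAt ht u).differentiableAt
  differentiable_normal u := ((hγ.normal hreg hκ).hasDerivAt ht u).differentiableAt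

end SliceContDiff

end Regularity

/-! ### Periodicity of the flux. -/

section Periodicity

variable {c : ℝ → E3} {a : ℝ}

theorem periodic_deriv {F : Type*} [NormedAddCommGroup F] [NormedSpace ℝ F] {f : ℝ → F}
    (hf : Function.Periodic f a) : Function.Periodic (deriv f) a := fun u => by
  rw [← deriv_comp_add_const, hf.funext]

theorem periodic_arcDeriv {F : Type*} [NormedAddCommGroup F] [NormedSpace ℝ F] {f : ℝ → F}
    (hc : Function.Periodic c a) (hf : Function.Periodic f a) :
    Function.Periodic (arcDeriv c f) a := fun u => by
  rw [arcDeriv, arcDeriv, speed, speed, periodic_deriv hc, periodic_deriv hf]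

theorem periodic_curvature (hc : Function.Periodic c a) : Function.Periodic (curvature c) a :=
  fun u => congrArg norm (periodic_arcDeriv hc (periodic_arcDeriv hc hc) u)

end Periodicity

/-- The θ-velocity enters ∂ₜψ₁ only through ψ₂υ, and this product has no denominators. -/
theorem cgcVelocity_zero_mul_psiTwo {c : ℝ → E3} {φ : ℝ → ℝ} {u : ℝ} (hψ : psiTwo c φ u ≠ 0) :
    psiTwo c φ u * cgcVelocity 0 c φ u =
      -((curvature c u * arcDeriv c (psiThree c φ) u
          + 2 * arcDeriv c (curvature c) u * psiThree c φ u) * Real.cos (φ u) * Real.sin (φ u))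
      - curvature c u * psiThree c φ u ^ 2
      - (arcDeriv c (arcDeriv c (curvature c)) u - curvature c u * psiThree c φ u ^ 2)
          * Real.sin (φ u) ^ 2 := by
  have h := hψ
  rw [psiTwo, mul_ne_zero_iff] at h
  obtain ⟨hκ, hs⟩ := h
  rw [cgcVelocity, psiOne, psiTwo]
  field_simp
  ring

/-! ### Evolution equations of the framed curvature flow. -/

namespace IsFramedCurvatureFlow

variable {tEnd t : ℝ} {γ : ℝ → ℝ → E3} {θ υ : ℝ → ℝ → ℝ}

theorem hasDerivAt_curve (h : IsFramedCurvatureFlow tEnd γ θ υ) (ht : t ∈ Ioo 0 tEnd) (u : ℝ) :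
    HasDerivAt (fun r => γ r u) (curvature (γ t) u • thetaNormal (γ t) (θ t) u) t :=
  (h.curve_evolution t (Ioo_subset_Ico_self ht) u).hasDerivAt (Ico_mem_nhds ht.1 ht.2)

theorem hasDerivAt_angle (h : IsFramedCurvatureFlow tEnd γ θ υ) (ht : t ∈ Ioo 0 tEnd) (u : ℝ) :
    HasDerivAt (fun r => θ r u) (υ t u) t :=
  (h.angle_evolution t (Ioo_subset_Ico_self ht) u).hasDerivAt (Ico_mem_nhds ht.1 ht.2)

theorem hasDerivAt_speed_and_curvature (h : IsFramedCurvatureFlow tEnd γ θ υ)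
    (hκ : ∀ t ∈ Ico 0 tEnd, ∀ u, curvature (γ t) u ≠ 0) (ht : t ∈ Ioo 0 tEnd) (u : ℝ) :
    HasDerivAt (fun r => speed (γ r) u)
      (-(curvature (γ t) u * psiOne (γ t) (θ t) u * speed (γ t) u)) t ∧
    HasDerivAt (fun r => curvature (γ r) u)
      ((arcDeriv (γ t) (arcDeriv (γ t) (curvature (γ t))) u
          - curvature (γ t) u * psiThree (γ t) (θ t) u ^ 2) * Real.cos (θ t u)
        - (2 * arcDeriv (γ t) (curvature (γ t)) u * psiThree (γ t) (θ t) u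
          + curvature (γ t) u * arcDeriv (γ t) (psiThree (γ t) (θ t)) u) * Real.sin (θ t u)
        + curvature (γ t) u ^ 2 * psiOne (γ t) (θ t) u) t := by
  have hγ := h.curve_contDiff.sliceContDiff
  have hθ := h.angle_contDiff.sliceContDiff
  have hreg := h.regular
  have ht' := Ioo_subset_Ico_self ht
  have hV := hγ.velocity hθ hreg hκ
  have h1 := hγ.of_succ.of_succ.of_succ.hasDerivAt_deriv_of_evolution hV.of_succ
    fun s hs v => h.hasDerivAt_curve hs v
  -- Commutation again, now for ∂ᵤγ with velocity ∂ᵤV; `h1` is its evolution equation.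
  have h2 := hγ.deriv.of_succ.of_succ.hasDerivAt_deriv_of_evolution hV.deriv h1
  have hc := hγ.of_succ.isFrenetCurve hreg hκ ht'
  have hK := hγ.curvature hreg hκ
  have hdκ : Differentiable ℝ (curvature (γ t)) :=
    fun v => (hK.hasDerivAt ht' v).differentiableAt
  have hdθ : Differentiable ℝ (θ t) := fun v => (hθ.hasDerivAt ht' v).differentiableAt
  have hT := hc.inner_arcDeriv_velocity_tangent (hdκ u) (hdθ u)
  have hN := hc.inner_arcDeriv_arcDeriv_velocity_normal (u := u) hdκ hdθ
    ((hK.arcDeriv hγ.of_succ.of_succ hreg).hasDerivAt ht' u).differentiableAt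
    ((hγ.psiThree hθ hreg hκ).hasDerivAt ht' u).differentiableAt
  refine ⟨?_, ?_⟩
  · refine (hasDerivAt_speed_of_evolution (hreg t ht' u) (h1 t ht u)).congr_deriv ?_
    rw [hT]
    ring
  · have hev : ∀ᶠ r in nhds t, r ∈ Ico 0 tEnd := Ico_mem_nhds ht.1 ht.2
    refine (hasDerivAt_curvature_of_evolution (hev.mono fun r hr => hreg r hr u)
      (hev.mono fun r hr => (hγ.deriv.hasDerivAt hr u).differentiableAt) hc
      (hV.deriv.hasDerivAt ht' u).differentiableAt (h1 t ht u) (h2 t ht u)).congr_deriv ?_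
    rw [hT, hN]
    ring

/-- For flat trajectory surfaces, `ψ₁ ds` evolves by the exact form `d(∂ₛκ)`. -/
theorem hasDerivAt_psiOne_mul_speed
    (h : IsFramedCurvatureFlow tEnd γ θ (fun t u => cgcVelocity 0 (γ t) (θ t) u))
    (hψ : ∀ t ∈ Ico 0 tEnd, ∀ u, psiTwo (γ t) (θ t) u ≠ 0) (ht : t ∈ Ioo 0 tEnd) (u : ℝ) :
    HasDerivAt (fun r => psiOne (γ r) (θ r) u * speed (γ r) u)
      (deriv (arcDeriv (γ t) (curvature (γ t))) u) t := by
  have ht' := Ioo_subset_Ico_self ht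
  obtain ⟨hg, hk⟩ := h.hasDerivAt_speed_and_curvature
    (fun s hs v => left_ne_zero_of_mul (hψ s hs v)) ht u
  have hυ := cgcVelocity_zero_mul_psiTwo (hψ t ht' u)
  refine ((hk.mul (h.hasDerivAt_angle ht u).cos).mul hg).congr_deriv ?_
  rw [← speed_smul_arcDeriv (h.regular t ht' u), smul_eq_mul]
  simp only [Pi.mul_apply]
  rw [psiTwo] at hυ
  simp only [psiOne]
  -- The cos² part of ∂ₛ²κ - κψ₃² comes from ∂ₜκ and the sin² part from -ψ₂υ, which also supplies
  -- the κψ₃² that removes the remainder. The κ²ψ₁ term cancels against ∂ₜg.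
  linear_combination (-speed (γ t) u) * hυ +
    speed (γ t) u * arcDeriv (γ t) (arcDeriv (γ t) (curvature (γ t))) u *
      Real.sin_sq_add_cos_sq (θ t u)
    - speed (γ t) u * curvature (γ t) u * psiThree (γ t) (θ t) u ^ 2 *
      Real.sin_sq_add_cos_sq (θ t u)

end IsFramedCurvatureFlow

end FramedCurve

end

theorem mainTheorem8 (tEnd : ℝ) (γ : ℝ → ℝ → E3) (θ : ℝ → ℝ → ℝ)
    (hflow : FramedCurve.IsFramedCurvatureFlow tEnd γ θ
      (fun t u => FramedCurve.cgcVelocity 0 (γ t) (θ t) u))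
    (hpsi : ∀ t ∈ Set.Ico 0 tEnd, ∀ u, FramedCurve.psiTwo (γ t) (θ t) u ≠ 0) :
    ∀ t ∈ Set.Ico 0 tEnd,
      FramedCurve.curveIntegral (γ t) (FramedCurve.psiOne (γ t) (θ t))
        = FramedCurve.curveIntegral (γ 0) (FramedCurve.psiOne (γ 0) (θ 0)) := by
  intro t ht
  have hγ := hflow.curve_contDiff.sliceContDiff
  have hreg := hflow.regular
  have hκ : ∀ t ∈ Set.Ico 0 tEnd, ∀ u, FramedCurve.curvature (γ t) u ≠ 0 :=
    fun s hs v => left_ne_zero_of_mul (hpsi s hs v)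
  have hK := hγ.curvature hreg hκ
  have hψ : FramedCurve.SliceContDiff (Set.Ico 0 tEnd) 0
      (fun t u => FramedCurve.psiOne (γ t) (θ t) u * FramedCurve.speed (γ t) u) :=
    (hK.of_succ.of_succ.mul hflow.angle_contDiff.sliceContDiff.of_succ.of_succ.cos_sin.1).mul
      (hγ.speed hreg).of_succ.of_succ.of_succ
  -- The flux is ∂ₛκ, of order one in u because γ has order four.
  refine FramedCurve.integral_eq_of_evolution_deriv hψ (hK.arcDeriv hγ.of_succ.of_succ hreg)
    (fun s hs u => hflow.hasDerivAt_psiOne_mul_speed hpsi hs u) (fun s hs => ?_) ht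
  have hper : Function.Periodic (γ s) (2 * Real.pi) := hflow.periodic s hs
  simpa using (FramedCurve.periodic_arcDeriv hper (FramedCurve.periodic_curvature hper) 0).symm
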